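/- Let $M$ be a (finite-dimensional) Kähler manifold, i.e. a complex manifold with a Hermitian Riemannian metric $g$ whose fundamental form $\omega(\cdot,\cdot)=g(J\cdot,\cdot)$ is closed, and suppose that $M$ has non-positive sectional curvature. Let $\gamma\colon S^1\to M$ be a closed geodesic, i.e. $\theta\mapsto\gamma(e^{i\theta})$ is a smooth curve satisfying the geodesic equation $\nabla_{\dot\gamma}\dot\gamma=0$ of the Levi-Civita connection for all $\theta\in\mathbb R$. Let $\mathbb D\subset\mathbb C$ be the open unit disc. Then there is no non-constant smooth map $u\colon\overline{\mathbb D}\to M$ that is holomorphic on $\mathbb D$ and satisfies $u|_{\partial\mathbb D}=\gamma$. -/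

import Mathlib

open Set Metric
open scoped Manifold ContDiff

noncomputable section

namespace KahlerGeom

section LocalRiemannian

variable {E : Type*} [NormedAddCommGroup E] [NormedSpace ℝ E]

/-- Christoffel operator of a local metric `G` (a field of bilinear forms on an open subset of `E`):
`Γ = christoffel G y v w` is the vector with
`2 G(Γ, z) = (∂_v G)(w, z) + (∂_w G)(v, z) - (∂_z G)(v, w)` for all `z`, i.e. the Levi-Civita
derivative `∇_v w` of the constant vector field `w`.  The metric `G y : E → E*` is inverted to raise
the index. -/
def christoffel (G : E → E →L[ℝ] E →L[ℝ] ℝ) (y v w : E) : E :=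
  (G y).inverse ((1 / 2 : ℝ) • (fderiv ℝ G y v w + fderiv ℝ G y w v
    - ((fderiv ℝ G y).flip v).flip w))

/-- Riemann curvature `R(u, v) w = ∇_u ∇_v w - ∇_v ∇_u w` of a local metric, for constant vector
fields `u`, `v`, `w`. -/
def riemannCurvature (G : E → E →L[ℝ] E →L[ℝ] ℝ) (y u v w : E) : E :=
  fderiv ℝ (fun y' => christoffel G y' v w) y u - fderiv ℝ (fun y' => christoffel G y' u w) y v
    + christoffel G y u (christoffel G y v w) - christoffel G y v (christoffel G y u w)

/-- Sectional curvature of the plane spanned by `u`, `v`. -/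
def sectionalCurvature (G : E → E →L[ℝ] E →L[ℝ] ℝ) (y u v : E) : ℝ :=
  G y (riemannCurvature G y u v v) u / (G y u u * G y v v - (G y u v) ^ 2)

end LocalRiemannian

variable {E : Type*} [NormedAddCommGroup E] [NormedSpace ℂ E]
variable {M : Type*} [TopologicalSpace M] [ChartedSpace E M]

/-- The smooth real manifold underlying a complex manifold. -/
instance isManifold_real [IsManifold 𝓘(ℂ, E) ω M] : IsManifold 𝓘(ℝ, E) ω M := by
  refine isManifold_of_contDiffOn _ _ _ fun e e' he he' => ?_
  exact (((contDiffGroupoid ω 𝓘(ℂ, E)).compatible he he').1).restrict_scalars ℝ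

/-- The complex structure `J` on `T_x M`.  The tangent space is identified with `E` through a
holomorphic chart at `x`, and `J` is multiplication by `i` there. -/
def complexStructure (x : M) : TangentSpace 𝓘(ℝ, E) x →L[ℝ] TangentSpace 𝓘(ℝ, E) x :=
  (Complex.I • ContinuousLinearMap.id ℝ E : E →L[ℝ] E)

/-- The expression in the chart `e` of a field of bilinear forms on the tangent spaces of `M`:
its pullback under `e.symm`. -/
def formInChart (b : (x : M) → TangentSpace 𝓘(ℝ, E) x →L[ℝ] TangentSpace 𝓘(ℝ, E) x →L[ℝ] ℝ)
    (e : OpenPartialHomeomorph M E) (y : E) : E →L[ℝ] E →L[ℝ] ℝ :=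
  let B : E →L[ℝ] E →L[ℝ] ℝ := b (e.symm y)
  let D : E →L[ℝ] E := mfderiv 𝓘(ℝ, E) 𝓘(ℝ, E) e.symm y
  B.bilinearComp D D

variable (E M) in
/-- Smooth Riemannian metrics on the complex manifold `M`. -/
abbrev RiemannMetric [IsManifold 𝓘(ℂ, E) ω M] :=
  Bundle.ContMDiffRiemannianMetric 𝓘(ℝ, E) ∞ E (fun x : M => TangentSpace 𝓘(ℝ, E) x)

variable [IsManifold 𝓘(ℂ, E) ω M]

/-- The fundamental form `ω(v, w) = g(J v, w)`. -/
def fundamentalForm (g : RiemannMetric E M) (x : M) :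
    TangentSpace 𝓘(ℝ, E) x →L[ℝ] TangentSpace 𝓘(ℝ, E) x →L[ℝ] ℝ :=
  (g.inner x).comp (complexStructure x)

/-- A Riemannian metric on a complex manifold is Kähler if it is Hermitian (`J` is isometric) and
its fundamental form is closed: in each chart `dω(u, v, w) = 0` for constant vector fields. -/
structure IsKahler (g : RiemannMetric E M) : Prop where
  hermitian : ∀ (x : M) (v w : TangentSpace 𝓘(ℝ, E) x),
    g.inner x (complexStructure x v) (complexStructure x w) = g.inner x v w
  closed : ∀ e ∈ atlas E M, ∀ y ∈ e.target, ∀ u v w : E,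
    fderiv ℝ (formInChart (fundamentalForm g) e) y u v w
      + fderiv ℝ (formInChart (fundamentalForm g) e) y v w u
      + fderiv ℝ (formInChart (fundamentalForm g) e) y w u v = 0

/-- All sectional curvatures are `≤ 0`. -/
def HasNonposSectionalCurvature (g : RiemannMetric E M) : Prop :=
  ∀ e ∈ atlas E M, ∀ y ∈ e.target, ∀ u v : E, LinearIndependent ℝ ![u, v] →
    sectionalCurvature (formInChart g.inner e) y u v ≤ 0

/-- A closed geodesic `γ : S¹ → M`: with `c θ = γ (exp (i θ))`, the curve `c` is smooth and
satisfies the geodesic equation `c'' + Γ(c', c') = 0` in all charts. -/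
structure IsClosedGeodesic (g : RiemannMetric E M) (γ : Circle → M) : Prop where
  smooth : ContMDiff 𝓘(ℝ, ℝ) 𝓘(ℝ, E) ∞ (fun θ : ℝ => γ (Circle.exp θ))
  geodesic : ∀ e ∈ atlas E M, ∀ θ : ℝ, γ (Circle.exp θ) ∈ e.source →
    deriv (deriv fun t : ℝ => e (γ (Circle.exp t))) θ
      + christoffel (formInChart g.inner e) (e (γ (Circle.exp θ)))
          (deriv (fun t : ℝ => e (γ (Circle.exp t))) θ)
          (deriv (fun t : ℝ => e (γ (Circle.exp t))) θ) = 0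

/-- A smooth disc `u : closed unit disc → M` (the values of `u` elsewhere are irrelevant) that is
holomorphic on the open unit disc. -/
structure IsHolomorphicDisc (E : Type*) [NormedAddCommGroup E] [NormedSpace ℂ E]
    {M : Type*} [TopologicalSpace M] [ChartedSpace E M] (u : ℂ → M) : Prop where
  smooth : ContMDiffOn 𝓘(ℝ, ℂ) 𝓘(ℝ, E) ∞ u (closedBall 0 1)
  holomorphic : MDifferentiableOn 𝓘(ℂ, ℂ) 𝓘(ℂ, E) u (ball 0 1)

end KahlerGeom

end

/-! The proof is a maximum principle for the energy density f = |∂u/∂x|² on the closed disc. In a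
holomorphic chart let v be the local expression of u, p = v', q = v'', and A = q + Γ(p, p) the
covariant acceleration. The Kähler condition makes Γ complex bilinear, so the derivative of f in
direction η is 2 G(ηA, p).

Inside the disc, Δf = 4|A|² + 2 G(∂̄Γ(p, p), p), where ∂̄Γ(p, p) is short for DΓ(p)(p, p) + i
DΓ(ip)(p, p). The last term is minus twice the curvature numerator of the plane (p, ip), hence
non-negative, and f is subharmonic (`laplacian_energy_nonneg`).

At a boundary point ζ the geodesic equation for u(exp(iθ)) becomes ζA = -p, so the outward radial
derivative of f is -2f. A maximum of f + ε|z|² cannot be interior, its Laplacian being at least 4ε,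
and at a boundary maximum -2f + 2ε ≥ 0 gives f(ζ) ≤ ε (`discEnergy_le_of_isMaxOn_of_norm_eq_one`).
Letting ε tend to 0 gives f = 0, so u is constant. -/

noncomputable section

namespace KahlerGeom

set_option maxSynthPendingDepth 4

/-! ### Smoothness of Christoffel symbols of a local metric -/

section LocalRiemannianSmooth

variable {E : Type*} [NormedAddCommGroup E] [NormedSpace ℝ E]

/-- The trilinear form lowered from the Christoffel operator, as an operator-valued map. -/
def loweredChristoffel (G : E → E →L[ℝ] E →L[ℝ] ℝ) (y : E) : E →L[ℝ] E →L[ℝ] E →L[ℝ] ℝ :=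
  (1 / 2 : ℝ) • (fderiv ℝ G y + (fderiv ℝ G y).flip
    - ((ContinuousLinearMap.flipₗᵢ ℝ E E ℝ).toContinuousLinearEquiv :
        (E →L[ℝ] E →L[ℝ] ℝ) →L[ℝ] (E →L[ℝ] E →L[ℝ] ℝ)) ∘L (fderiv ℝ G y).flip)

/-- The Christoffel operator as a map into bounded bilinear maps. -/
def christoffelOp (G : E → E →L[ℝ] E →L[ℝ] ℝ) (y : E) : E →L[ℝ] E →L[ℝ] E :=
  (ContinuousLinearMap.compL ℝ E (E →L[ℝ] ℝ) E (G y).inverse) ∘L loweredChristoffel G y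

theorem christoffelOp_apply (G : E → E →L[ℝ] E →L[ℝ] ℝ) (y v w : E) :
    christoffelOp G y v w = christoffel G y v w := by
  simp only [christoffelOp, christoffel, loweredChristoffel]
  rfl

theorem contDiffAt_christoffelOp {G : E → E →L[ℝ] E →L[ℝ] ℝ} {y : E} [CompleteSpace E]
    (hG : ContDiffAt ℝ ∞ G y) (hi : (G y).IsInvertible) :
    ContDiffAt ℝ ∞ (christoffelOp G) y := by
  have hd : ContDiffAt ℝ ∞ (fderiv ℝ G) y := hG.fderiv_right (by simp)
  have hflip : ContDiffAt ℝ ∞ (fun y => (fderiv ℝ G y).flip) y :=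
    (ContinuousLinearMap.flipₗᵢ ℝ E E (E →L[ℝ] ℝ)).contDiff.contDiffAt.comp y hd
  have hlow : ContDiffAt ℝ ∞ (loweredChristoffel G) y :=
    ((hd.add hflip).sub (contDiffAt_const.clm_comp hflip)).const_smul (1 / 2 : ℝ)
  obtain ⟨e, he⟩ := hi
  have hinv : ContDiffAt ℝ ∞ (fun y => (G y).inverse) y := by
    have h1 : ContDiffAt ℝ ∞ (ContinuousLinearMap.inverse : (E →L[ℝ] E →L[ℝ] ℝ) → _) (G y) :=
      he ▸ contDiffAt_map_inverse e
    exact h1.comp y hG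
  have hcomp : ContDiffAt ℝ ∞
      (fun y => ContinuousLinearMap.compL ℝ E (E →L[ℝ] ℝ) E (G y).inverse) y :=
    contDiffAt_const.clm_apply hinv
  exact hcomp.clm_comp hlow

end LocalRiemannianSmooth

/-! ### Local Kähler geometry: complex bilinear Christoffel symbols and curvature -/

section LocalKahler

variable {E : Type*} [NormedAddCommGroup E] [NormedSpace ℂ E]

/-- A smooth local metric on an open set `U` that is Kähler for the constant complex structure. -/
structure IsLocalKahler (G : E → E →L[ℝ] E →L[ℝ] ℝ) (U : Set E) : Prop where
  isOpen : IsOpen U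
  contDiffOn : ContDiffOn ℝ ∞ G U
  symm : ∀ y ∈ U, ∀ v w, G y v w = G y w v
  pos : ∀ y ∈ U, ∀ v, v ≠ 0 → 0 < G y v v
  hermitian : ∀ y ∈ U, ∀ v w, G y (Complex.I • v) (Complex.I • w) = G y v w
  closed : ∀ y ∈ U, ∀ u v w, fderiv ℝ G y u (Complex.I • v) w
    + fderiv ℝ G y v (Complex.I • w) u + fderiv ℝ G y w (Complex.I • u) v = 0

namespace IsLocalKahler

variable {G : E → E →L[ℝ] E →L[ℝ] ℝ} {U : Set E} {y : E}

theorem contDiffAt (h : IsLocalKahler G U) (hy : y ∈ U) : ContDiffAt ℝ ∞ G y :=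
  h.contDiffOn.contDiffAt (h.isOpen.mem_nhds hy)

theorem hasFDerivAt (h : IsLocalKahler G U) (hy : y ∈ U) : HasFDerivAt G (fderiv ℝ G y) y :=
  ((h.contDiffAt hy).differentiableAt (by simp)).hasFDerivAt

theorem hasFDerivAt_apply (h : IsLocalKahler G U) (hy : y ∈ U) (v w : E) :
    HasFDerivAt (fun y => G y v w) (((fderiv ℝ G y).flip v).flip w) y := by
  have h1 := ((h.hasFDerivAt hy).clm_apply (hasFDerivAt_const v y)).clm_apply
    (hasFDerivAt_const w y)
  refine h1.congr_fderiv ?_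
  ext a
  simp

theorem fderiv_symm (h : IsLocalKahler G U) (hy : y ∈ U) (a v w : E) :
    fderiv ℝ G y a v w = fderiv ℝ G y a w v := by
  have h1 := h.hasFDerivAt_apply hy v w
  have h2 := h.hasFDerivAt_apply hy w v
  have h3 : (fun y => G y v w) =ᶠ[nhds y] fun y => G y w v := by
    filter_upwards [h.isOpen.mem_nhds hy] with x hx using h.symm x hx v w
  exact DFunLike.congr_fun (h1.unique (h2.congr_of_eventuallyEq h3)) a

theorem fderiv_hermitian (h : IsLocalKahler G U) (hy : y ∈ U) (a v w : E) :
    fderiv ℝ G y a (Complex.I • v) (Complex.I • w) = fderiv ℝ G y a v w := by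
  have h1 := h.hasFDerivAt_apply hy (Complex.I • v) (Complex.I • w)
  have h2 := h.hasFDerivAt_apply hy v w
  have h3 : (fun y => G y (Complex.I • v) (Complex.I • w)) =ᶠ[nhds y] fun y => G y v w := by
    filter_upwards [h.isOpen.mem_nhds hy] with x hx using h.hermitian x hx v w
  exact DFunLike.congr_fun (h1.unique (h2.congr_of_eventuallyEq h3)) a

theorem apply_I_left (h : IsLocalKahler G U) (hy : y ∈ U) (v w : E) :
    G y (Complex.I • v) w = - G y v (Complex.I • w) := by
  rw [← h.hermitian y hy v (Complex.I • w), smul_smul Complex.I Complex.I w]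
  simp

theorem fderiv_apply_I_left (h : IsLocalKahler G U) (hy : y ∈ U) (a v w : E) :
    fderiv ℝ G y a (Complex.I • v) w = - fderiv ℝ G y a v (Complex.I • w) := by
  rw [← h.fderiv_hermitian hy a v (Complex.I • w), smul_smul Complex.I Complex.I w]
  simp

theorem apply_self_I (h : IsLocalKahler G U) (hy : y ∈ U) (v : E) :
    G y v (Complex.I • v) = 0 := by
  have h1 := h.apply_I_left hy v v
  rw [h.symm y hy] at h1
  linarith

theorem nonneg (h : IsLocalKahler G U) (hy : y ∈ U) (v : E) : 0 ≤ G y v v := by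
  by_cases hv : v = 0
  · simp [hv]
  · exact (h.pos y hy v hv).le

theorem injective (h : IsLocalKahler G U) (hy : y ∈ U) : Function.Injective (G y) := by
  rw [injective_iff_map_eq_zero]
  intro v hv
  by_contra hne
  have := h.pos y hy v hne
  simp [hv] at this

theorem eq_of_forall_apply (h : IsLocalKahler G U) (hy : y ∈ U) {v w : E}
    (hvw : ∀ z, 2 * G y v z = 2 * G y w z) : v = w := by
  refine h.injective hy (ContinuousLinearMap.ext fun z => ?_)
  linarith [hvw z]

variable [FiniteDimensional ℂ E]

theorem isInvertible (h : IsLocalKahler G U) (hy : y ∈ U) : (G y).IsInvertible := by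
  have hfin : Module.finrank ℝ E = Module.finrank ℝ (E →L[ℝ] ℝ) := by
    rw [← (LinearMap.toContinuousLinearMap (𝕜 := ℝ) (E := E) (F' := ℝ)).finrank_eq]
    exact (Subspace.dual_finrank_eq (K := ℝ) (V := E)).symm
  refine ⟨(LinearEquiv.ofInjectiveOfFinrankEq (G y : E →ₗ[ℝ] E →L[ℝ] ℝ)
    (h.injective hy) hfin).toContinuousLinearEquiv, ?_⟩
  ext v w
  rfl

theorem apply_christoffel (h : IsLocalKahler G U) (hy : y ∈ U) (v w z : E) :
    2 * G y (christoffelOp G y v w) z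
      = fderiv ℝ G y v w z + fderiv ℝ G y w v z - fderiv ℝ G y z v w := by
  rw [christoffelOp_apply, christoffel, (h.isInvertible hy).self_apply_inverse]
  simp

/-- Metric compatibility ∇G = 0, from adding two Koszul identities. -/
theorem fderiv_eq (h : IsLocalKahler G U) (hy : y ∈ U) (a v w : E) :
    fderiv ℝ G y a v w = G y (christoffelOp G y a v) w + G y v (christoffelOp G y a w) := by
  have h1 := h.apply_christoffel hy a v w
  have h2 := h.apply_christoffel hy a w v
  rw [h.symm y hy v]
  have h3 := h.fderiv_symm hy a v w
  have h4 := h.fderiv_symm hy v a w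
  have h5 := h.fderiv_symm hy w a v
  linarith

theorem christoffelOp_symm (h : IsLocalKahler G U) (hy : y ∈ U) (v w : E) :
    christoffelOp G y v w = christoffelOp G y w v := by
  refine h.eq_of_forall_apply hy fun z => ?_
  rw [h.apply_christoffel hy, h.apply_christoffel hy, h.fderiv_symm hy z]
  ring

/-- This is ∇J = 0: for a Hermitian metric, closedness of ω makes J parallel. Together with the
symmetry of Γ it yields complex bilinearity. -/
theorem christoffelOp_I_right (h : IsLocalKahler G U) (hy : y ∈ U) (v w : E) :
    christoffelOp G y v (Complex.I • w) = Complex.I • christoffelOp G y v w := by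
  refine h.eq_of_forall_apply hy fun z => ?_
  -- With v = it, closedness at (iw, t, z) and at (w, t, iz) produces the derivatives in the two
  -- Koszul formulas; the derivatives along t cancel by hermiticity.
  obtain ⟨t, rfl⟩ : ∃ t, v = Complex.I • t :=
    ⟨-(Complex.I • v), by rw [smul_neg, smul_smul]; simp⟩
  rw [h.apply_I_left hy, mul_neg, h.apply_christoffel hy, h.apply_christoffel hy]
  have e1 := h.closed y hy (Complex.I • w) t z
  have e2 := h.closed y hy w t (Complex.I • z)
  have e3 := h.fderiv_apply_I_left hy (Complex.I • t) w z
  have e4 := h.fderiv_hermitian hy t z w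
  have e5 := h.fderiv_hermitian hy z t w
  have e6 := h.fderiv_apply_I_left hy (Complex.I • z) w t
  have e7 := h.fderiv_symm hy (Complex.I • z) w (Complex.I • t)
  simp only [smul_smul, Complex.I_mul_I, neg_smul, one_smul, map_neg,
    neg_apply] at e1 e2 e5
  have e8 := h.fderiv_symm hy z w t
  linarith

theorem christoffelOp_I_left (h : IsLocalKahler G U) (hy : y ∈ U) (v w : E) :
    christoffelOp G y (Complex.I • v) w = Complex.I • christoffelOp G y v w := by
  rw [h.christoffelOp_symm hy, h.christoffelOp_I_right hy, h.christoffelOp_symm hy]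

theorem christoffelOp_smul_right (h : IsLocalKahler G U) (hy : y ∈ U) (c : ℂ) (v w : E) :
    christoffelOp G y v (c • w) = c • christoffelOp G y v w := by
  have key (x : E) : c • x = c.re • x + c.im • Complex.I • x := by
    conv_lhs => rw [← Complex.re_add_im c, add_smul, mul_smul]
    simp
  rw [key, map_add, map_smul, map_smul, h.christoffelOp_I_right hy, ← key]

theorem christoffelOp_smul_left (h : IsLocalKahler G U) (hy : y ∈ U) (c : ℂ) (v w : E) :
    christoffelOp G y (c • v) w = c • christoffelOp G y v w := by
  rw [h.christoffelOp_symm hy, h.christoffelOp_smul_right hy, h.christoffelOp_symm hy]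

theorem contDiffAt_christoffelOp (h : IsLocalKahler G U) (hy : y ∈ U) :
    ContDiffAt ℝ ∞ (christoffelOp G) y :=
  have : CompleteSpace E := FiniteDimensional.complete ℂ E
  KahlerGeom.contDiffAt_christoffelOp (h.contDiffAt hy) (h.isInvertible hy)

theorem hasFDerivAt_christoffelOp (h : IsLocalKahler G U) (hy : y ∈ U) :
    HasFDerivAt (christoffelOp G) (fderiv ℝ (christoffelOp G) y) y :=
  ((h.contDiffAt_christoffelOp hy).differentiableAt (by simp)).hasFDerivAt

theorem hasFDerivAt_christoffelOp_apply (h : IsLocalKahler G U) (hy : y ∈ U) (v w : E) :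
    HasFDerivAt (fun y => christoffelOp G y v w)
      (((fderiv ℝ (christoffelOp G) y).flip v).flip w) y := by
  have h1 := ((h.hasFDerivAt_christoffelOp hy).clm_apply (hasFDerivAt_const v y)).clm_apply
    (hasFDerivAt_const w y)
  refine h1.congr_fderiv ?_
  ext a
  simp

theorem fderiv_christoffelOp_I_right (h : IsLocalKahler G U) (hy : y ∈ U) (a v w : E) :
    fderiv ℝ (christoffelOp G) y a v (Complex.I • w)
      = Complex.I • fderiv ℝ (christoffelOp G) y a v w := by
  have h1 := h.hasFDerivAt_christoffelOp_apply hy v (Complex.I • w)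
  have h2 := (h.hasFDerivAt_christoffelOp_apply hy v w).const_smul Complex.I
  have h3 : (fun y => christoffelOp G y v (Complex.I • w)) =ᶠ[nhds y]
      fun y => Complex.I • christoffelOp G y v w := by
    filter_upwards [h.isOpen.mem_nhds hy] with x hx using h.christoffelOp_I_right hx v w
  exact DFunLike.congr_fun (h1.unique (h2.congr_of_eventuallyEq h3)) a

theorem fderiv_christoffelOp_I_left (h : IsLocalKahler G U) (hy : y ∈ U) (a v w : E) :
    fderiv ℝ (christoffelOp G) y a (Complex.I • v) w
      = Complex.I • fderiv ℝ (christoffelOp G) y a v w := by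
  have h1 := h.hasFDerivAt_christoffelOp_apply hy (Complex.I • v) w
  have h2 := (h.hasFDerivAt_christoffelOp_apply hy v w).const_smul Complex.I
  have h3 : (fun y => christoffelOp G y (Complex.I • v) w) =ᶠ[nhds y]
      fun y => Complex.I • christoffelOp G y v w := by
    filter_upwards [h.isOpen.mem_nhds hy] with x hx using h.christoffelOp_I_left hx v w
  exact DFunLike.congr_fun (h1.unique (h2.congr_of_eventuallyEq h3)) a

/-- The curvature in a complex direction is the `∂̄`-derivative of the Christoffel operator. -/
theorem riemannCurvature_I (h : IsLocalKahler G U) (hy : y ∈ U) (p : E) :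
    riemannCurvature G y p (Complex.I • p) (Complex.I • p)
      = - (fderiv ℝ (christoffelOp G) y p p p
        + Complex.I • fderiv ℝ (christoffelOp G) y (Complex.I • p) p p) := by
  simp only [riemannCurvature, ← christoffelOp_apply]
  rw [(h.hasFDerivAt_christoffelOp_apply hy _ _).fderiv,
    (h.hasFDerivAt_christoffelOp_apply hy _ _).fderiv]
  -- By complex bilinearity both quadratic terms equal -Γ(p, Γ(p, p)) and cancel.
  simp only [ContinuousLinearMap.flip_apply, h.fderiv_christoffelOp_I_right hy,
    h.fderiv_christoffelOp_I_left hy, h.christoffelOp_I_left hy, h.christoffelOp_I_right hy,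
    smul_smul, Complex.I_mul_I, neg_smul, one_smul, map_neg]
  abel

/-- Non-positivity of the holomorphic sectional curvature, without denominators. -/
theorem apply_dbar_christoffelOp_nonneg (h : IsLocalKahler G U) (hy : y ∈ U)
    (hK : ∀ u v : E, LinearIndependent ℝ ![u, v] → sectionalCurvature G y u v ≤ 0) (p : E) :
    0 ≤ G y (fderiv ℝ (christoffelOp G) y p p p
        + Complex.I • fderiv ℝ (christoffelOp G) y (Complex.I • p) p p) p := by
  by_cases hp : p = 0
  · simp [hp]
  have hli : LinearIndependent ℝ ![p, Complex.I • p] := by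
    rw [LinearIndependent.pair_iff]
    intro s t hst
    have h1 : ((s : ℂ) + t * Complex.I) • p = 0 := by
      rw [add_smul, mul_smul]
      simpa using hst
    have h2 := (smul_eq_zero.1 h1).resolve_right hp
    constructor
    · simpa using congrArg Complex.re h2
    · simpa using congrArg Complex.im h2
  have hpos := h.pos y hy p hp
  have h1 := hK _ _ hli
  rw [sectionalCurvature, h.riemannCurvature_I hy, h.apply_self_I hy, h.hermitian y hy,
    map_neg, neg_apply, div_nonpos_iff] at h1
  rcases h1 with h1 | h1
  -- The denominator is G(p, p)² > 0, since p and ip are orthogonal of equal length; it cannot be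
  -- non-positive.
  · nlinarith [mul_pos hpos hpos]
  · linarith

end IsLocalKahler
end LocalKahler

/-! ### One-variable second derivative test -/

/-- Second derivative test: at a local maximum the second derivative is non-positive. -/
theorem second_deriv_nonpos_of_isLocalMax {φ ψ : ℝ → ℝ} {a d : ℝ} (hmax : IsLocalMax φ a)
    (hφ : ∀ᶠ t in nhds a, HasDerivAt φ (ψ t) t) (hψ : HasDerivAt ψ d a) : d ≤ 0 := by
  by_contra! hd
  have hderiv : deriv φ =ᶠ[nhds a] ψ := hφ.mono fun t ht => ht.deriv
  have hdd : deriv (deriv φ) a = d := hderiv.deriv_eq.trans hψ.deriv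
  -- A positive second derivative would make `a` a local minimum too, so φ would be locally constant
  -- and its second derivative zero.
  have hmin : IsLocalMin φ a := isLocalMin_of_deriv_deriv_pos (hdd ▸ hd) hmax.deriv_eq_zero
    hφ.self_of_nhds.continuousAt
  have hconst : φ =ᶠ[nhds a] fun _ => φ a := by
    filter_upwards [hmax, hmin] with t h1 h2 using le_antisymm h1 h2
  have hzero : deriv φ =ᶠ[nhds a] fun _ => 0 := by
    refine hconst.deriv.trans (Filter.Eventually.of_forall fun t => ?_)
    simp
  have := hzero.deriv_eq
  rw [hdd] at this
  simp at this
  exact hd.ne' this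

/-! ### Energy density of a holomorphic map into a local Kähler metric -/

section Energy

variable {E : Type*} [NormedAddCommGroup E] [NormedSpace ℂ E] [FiniteDimensional ℂ E]
variable {G : E → E →L[ℝ] E →L[ℝ] ℝ} {U : Set E} {v p q : ℂ → E} {s : Set ℂ} {z : ℂ}

/-- The covariant acceleration `∇_x v_x` of a holomorphic map `v` with derivatives `p`, `q`. -/
def covAcceleration (G : E → E →L[ℝ] E →L[ℝ] ℝ) (v p q : ℂ → E) (z : ℂ) : E :=
  q z + christoffelOp G (v z) (p z) (p z)

/-- Real differential of the squared length of the derivative of a holomorphic map. -/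
theorem IsLocalKahler.hasFDerivWithinAt_energy (h : IsLocalKahler G U) (hz : v z ∈ U)
    (hv : HasDerivWithinAt v (p z) s z) (hp : HasDerivWithinAt p (q z) s z) :
    HasFDerivWithinAt (fun z => G (v z) (p z) (p z))
      ((2 : ℝ) • ((G (v z)).flip (p z) ∘L
        (ContinuousLinearMap.toSpanSingleton ℂ (covAcceleration G v p q z)).restrictScalars ℝ))
      s z := by
  have hv' := hv.hasFDerivWithinAt.restrictScalars ℝ
  have hp' := hp.hasFDerivWithinAt.restrictScalars ℝ
  have hG := (h.hasFDerivAt hz).comp_hasFDerivWithinAt z hv'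
  refine ((hG.clm_apply hp').clm_apply hp').congr_fderiv ?_
  ext η
  simp [covAcceleration, h.fderiv_eq hz, h.symm _ hz (p z), h.christoffelOp_smul_left hz]
  ring

/-- The second derivative of the squared length of the derivative, in the real direction `η`. -/
theorem IsLocalKahler.hasFDerivAt_energyDeriv (h : IsLocalKahler G U) (hz : v z ∈ U)
    (hv : HasDerivAt v (p z) z) (hp : HasDerivAt p (q z) z) {r : E} (hq : HasDerivAt q r z)
    (η : ℂ) :
    ∃ L : ℂ →L[ℝ] ℝ,
      HasFDerivAt (fun z => 2 * G (v z) (η • covAcceleration G v p q z) (p z)) L z ∧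
      L η = 2 * (G (v z) (η • covAcceleration G v p q z) (η • covAcceleration G v p q z)
        + G (v z) (christoffelOp G (v z) (η • p z) (η • covAcceleration G v p q z)
          + η • (η • r + fderiv ℝ (christoffelOp G) (v z) (η • p z) (p z) (p z)
            + christoffelOp G (v z) (η • q z) (p z)
            + christoffelOp G (v z) (p z) (η • q z))) (p z)) := by
  have hv' := hv.hasFDerivAt.restrictScalars ℝ
  have hp' := hp.hasFDerivAt.restrictScalars ℝ
  have hq' := hq.hasFDerivAt.restrictScalars ℝ
  have hG := (h.hasFDerivAt hz).comp z hv'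
  have hΓ := (h.hasFDerivAt_christoffelOp hz).comp z hv'
  have hA := (hq'.add ((hΓ.clm_apply hp').clm_apply hp')).const_smul η
  refine ⟨_, ((hG.clm_apply hA).clm_apply hp').const_mul 2, ?_⟩
  simp only [covAcceleration, add_apply, smul_apply, Function.comp_apply,
    ContinuousLinearMap.comp_apply, ContinuousLinearMap.flip_apply,
    ContinuousLinearMap.coe_restrictScalars', ContinuousLinearMap.toSpanSingleton_apply,
    h.fderiv_eq hz, h.christoffelOp_smul_left hz, h.christoffelOp_smul_right hz,
    smul_add, map_add, smul_eq_mul, Pi.add_apply, Pi.smul_apply]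
  ring

/-- The squared length of the derivative of a holomorphic map has non-negative Laplacian when
the curvature is non-positive. -/
theorem IsLocalKahler.laplacian_energy_nonneg (h : IsLocalKahler G U) (hz : v z ∈ U)
    (hK : ∀ a b : E, LinearIndependent ℝ ![a, b] → sectionalCurvature G (v z) a b ≤ 0)
    (hv : HasDerivAt v (p z) z) (hp : HasDerivAt p (q z) z) {r : E} (hq : HasDerivAt q r z) :
    ∃ L₁ L₂ : ℂ →L[ℝ] ℝ,
      HasFDerivAt (fun z => 2 * G (v z) ((1 : ℂ) • covAcceleration G v p q z) (p z)) L₁ z ∧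
      HasFDerivAt (fun z => 2 * G (v z) (Complex.I • covAcceleration G v p q z) (p z)) L₂ z ∧
      0 ≤ L₁ 1 + L₂ Complex.I := by
  obtain ⟨L₁, hL₁, e₁⟩ := h.hasFDerivAt_energyDeriv hz hv hp hq 1
  obtain ⟨L₂, hL₂, e₂⟩ := h.hasFDerivAt_energyDeriv hz hv hp hq Complex.I
  refine ⟨L₁, L₂, hL₁, hL₂, ?_⟩
  have hnn := h.nonneg hz (covAcceleration G v p q z)
  have hR := h.apply_dbar_christoffelOp_nonneg hz hK (p z)
  rw [e₁, e₂, h.hermitian _ hz]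
  -- Terms complex bilinear in η cancel because 1² + i² = 0; this removes the third derivative r.
  -- What remains is 4|A|² plus twice the curvature term.
  simp only [one_smul, smul_add, map_add, add_apply, h.christoffelOp_I_left hz,
    h.christoffelOp_I_right hz, smul_smul, Complex.I_mul_I, neg_smul, map_neg, neg_apply] at hR ⊢
  linarith

end Energy

/-! ### From the global Kähler metric to local Kähler metrics in charts -/

section Charts

variable {E : Type*} [NormedAddCommGroup E] [NormedSpace ℂ E]
variable {M : Type*} [TopologicalSpace M] [ChartedSpace E M]

theorem hasMFDerivAt_restrictScalars {e : E → M} {y : E} {D : E →L[ℂ] E}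
    (h : HasMFDerivAt 𝓘(ℂ, E) 𝓘(ℂ, E) e y D) :
    HasMFDerivAt 𝓘(ℝ, E) 𝓘(ℝ, E) e y (D.restrictScalars ℝ : E →L[ℝ] E) :=
  ⟨h.1, HasFDerivWithinAt.restrictScalars ℝ h.2⟩

theorem formInChart_apply
    (b : (x : M) → TangentSpace 𝓘(ℝ, E) x →L[ℝ] TangentSpace 𝓘(ℝ, E) x →L[ℝ] ℝ)
    (e : OpenPartialHomeomorph M E) (y v w : E) :
    formInChart b e y v w = b (e.symm y) (mfderiv 𝓘(ℝ, E) 𝓘(ℝ, E) e.symm y v)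
      (mfderiv 𝓘(ℝ, E) 𝓘(ℝ, E) e.symm y w) := rfl

variable [IsManifold 𝓘(ℂ, E) ω M] {e : OpenPartialHomeomorph M E}

/-- Charts are holomorphic, so the real derivative of an inverse chart is the restriction of a
complex linear map and commutes with J. -/
theorem mfderiv_symm_I_smul (he : e ∈ atlas E M) {y : E} (hy : y ∈ e.target) (v : E) :
    (mfderiv 𝓘(ℝ, E) 𝓘(ℝ, E) e.symm y : E →L[ℝ] E) (Complex.I • v)
      = complexStructure (e.symm y) ((mfderiv 𝓘(ℝ, E) 𝓘(ℝ, E) e.symm y : E →L[ℝ] E) v) := by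
  have : IsManifold 𝓘(ℂ, E) 1 M := IsManifold.of_le (n := ω) (by simp)
  have h := (mdifferentiableAt_atlas_symm (I := 𝓘(ℂ, E)) he hy).hasMFDerivAt
  rw [(hasMFDerivAt_restrictScalars h).mfderiv]
  exact map_smul (mfderiv 𝓘(ℂ, E) 𝓘(ℂ, E) e.symm y : E →L[ℂ] E) Complex.I v

theorem formInChart_fundamentalForm (g : RiemannMetric E M) (he : e ∈ atlas E M) {y : E}
    (hy : y ∈ e.target) (v w : E) :
    formInChart (fundamentalForm g) e y v w = formInChart g.inner e y (Complex.I • v) w := by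
  rw [formInChart_apply, formInChart_apply]
  exact congrArg (fun x => g.inner (e.symm y) x _) (mfderiv_symm_I_smul he hy v).symm

theorem contMDiffOn_mfderiv_symm (he : e ∈ atlas E M) (v : E) :
    ContMDiffOn 𝓘(ℝ, E) 𝓘(ℝ, E).tangent ∞
      (fun y => (⟨e.symm y, mfderiv 𝓘(ℝ, E) 𝓘(ℝ, E) e.symm y v⟩ : TangentBundle 𝓘(ℝ, E) M))
      e.target := by
  have hs : ContMDiffOn 𝓘(ℝ, E) 𝓘(ℝ, E) ω e.symm e.target :=
    contMDiffOn_symm_of_mem_maximalAtlas (IsManifold.subset_maximalAtlas he)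
  have : IsManifold 𝓘(ℝ, E) 1 M := IsManifold.of_le (n := ω) (by simp)
  have ht := hs.contMDiffOn_tangentMapWithin (m := ∞) (by simp) e.open_target.uniqueMDiffOn
  have hc : ContMDiff 𝓘(ℝ, E) 𝓘(ℝ, E).tangent ∞
      (fun y : E => (⟨y, v⟩ : TangentBundle 𝓘(ℝ, E) E)) :=
    contMDiff_vectorSpace_iff_contDiff.2 contDiff_const
  refine (ht.comp hc.contMDiffOn (fun y hy => hy)).congr fun y hy => ?_
  simp only [Function.comp_apply, tangentMapWithin]
  rw [mfderivWithin_of_mem_nhds (e.open_target.mem_nhds hy)]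

theorem formInChart_pos (g : RiemannMetric E M) (he : e ∈ atlas E M) {y : E}
    (hy : y ∈ e.target) {v : E} (hv : v ≠ 0) : 0 < formInChart g.inner e y v v := by
  have : IsManifold 𝓘(ℝ, E) 1 M := IsManifold.of_le (n := ω) (by simp)
  rw [formInChart_apply]
  refine g.pos _ _ fun h0 => hv ?_
  have hinj := ((mdifferentiable_of_mem_atlas (I := 𝓘(ℝ, E)) he).symm).mfderiv_injective
    (show y ∈ e.symm.source from hy)
  exact hinj (h0.trans (map_zero _).symm)

theorem IsKahler.formInChart_hermitian {g : RiemannMetric E M} (hg : IsKahler g)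
    (he : e ∈ atlas E M) {y : E} (hy : y ∈ e.target) (v w : E) :
    formInChart g.inner e y (Complex.I • v) (Complex.I • w) = formInChart g.inner e y v w := by
  refine Eq.trans ?_ (hg.hermitian (e.symm y) _ _)
  have h1 := mfderiv_symm_I_smul he hy v
  have h2 := mfderiv_symm_I_smul he hy w
  exact congrArg₂ (fun a b => g.inner (e.symm y) a b) h1 h2

variable [FiniteDimensional ℂ E]

theorem contDiffOn_formInChart (g : RiemannMetric E M) (he : e ∈ atlas E M) :
    ContDiffOn ℝ ∞ (formInChart g.inner e) e.target := by
  have : FiniteDimensional ℝ E := FiniteDimensional.complexToReal E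
  refine contDiffOn_clm_apply.2 fun v => contDiffOn_clm_apply.2 fun w => ?_
  have : IsManifold 𝓘(ℝ, E) 1 M := IsManifold.of_le (n := ω) (by simp)
  have hs : ContMDiffOn 𝓘(ℝ, E) 𝓘(ℝ, E) ω e.symm e.target :=
    contMDiffOn_symm_of_mem_maximalAtlas (IsManifold.subset_maximalAtlas he)
  intro y hy
  have h1 := (g.contMDiff.contMDiffAt.comp_contMDiffWithinAt y ((hs y hy).of_le (by simp)))
  have h2 := h1.clm_bundle_apply₂ (F₁ := E) (F₂ := E) (F₃ := ℝ) (E₃ := Bundle.Trivial M ℝ)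
    (contMDiffOn_mfderiv_symm he v y hy) (contMDiffOn_mfderiv_symm he w y hy)
  rw [Bundle.contMDiffWithinAt_totalSpace] at h2
  exact h2.2.contDiffWithinAt

theorem fderiv_formInChart_fundamentalForm (g : RiemannMetric E M) (he : e ∈ atlas E M) {y : E}
    (hy : y ∈ e.target) (u v w : E) :
    fderiv ℝ (formInChart (fundamentalForm g) e) y u v w
      = fderiv ℝ (formInChart g.inner e) y u (Complex.I • v) w := by
  have hG : HasFDerivAt (formInChart g.inner e) (fderiv ℝ (formInChart g.inner e) y) y :=
    (((contDiffOn_formInChart g he).contDiffAt (e.open_target.mem_nhds hy)).differentiableAt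
      (by simp)).hasFDerivAt
  let J : E →L[ℝ] E := Complex.I • ContinuousLinearMap.id ℝ E
  let C := (ContinuousLinearMap.compL ℝ E E (E →L[ℝ] ℝ)).flip J
  have key : HasFDerivAt (formInChart (fundamentalForm g) e)
      (C ∘L fderiv ℝ (formInChart g.inner e) y) y := by
    refine (C.hasFDerivAt.comp y hG).congr_of_eventuallyEq ?_
    filter_upwards [e.open_target.mem_nhds hy] with x hx
    ext v w
    exact formInChart_fundamentalForm g he hx v w
  rw [key.fderiv]
  rfl

theorem IsKahler.isLocalKahler {g : RiemannMetric E M} (hg : IsKahler g) (he : e ∈ atlas E M) :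
    IsLocalKahler (formInChart g.inner e) e.target where
  isOpen := e.open_target
  contDiffOn := contDiffOn_formInChart g he
  symm y _ v w := g.symm (e.symm y) _ _
  pos y hy v hv := formInChart_pos g he hy hv
  hermitian y hy v w := hg.formInChart_hermitian he hy v w
  closed y hy u v w := by
    have h := hg.closed e he y hy u v w
    rwa [fderiv_formInChart_fundamentalForm g he hy, fderiv_formInChart_fundamentalForm g he hy,
      fderiv_formInChart_fundamentalForm g he hy] at h

end Charts

/-! ### Complex derivatives up to the boundary of the disc -/

section Disc

variable {E : Type*} [NormedAddCommGroup E] [NormedSpace ℂ E] [CompleteSpace E]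

theorem uniqueDiffOn_closedBall_inter {N : Set ℂ} (hN : IsOpen N) :
    UniqueDiffOn ℝ (closedBall (0 : ℂ) 1 ∩ N) := by
  refine (uniqueDiffOn_convex (convex_closedBall _ _) ?_).inter hN
  exact ⟨0, interior_mono ball_subset_closedBall (by simp [isOpen_ball.interior_eq])⟩

/-- The Cauchy–Riemann equations extend to the boundary of the disc: the derivative of a map that
is smooth up to the boundary and holomorphic inside is again such a map. -/
theorem exists_hasDerivWithinAt_closedBall {N : Set ℂ} (hN : IsOpen N) {v : ℂ → E}
    (hv : ContDiffOn ℝ ∞ v (closedBall 0 1 ∩ N)) (hd : DifferentiableOn ℂ v (ball 0 1 ∩ N)) :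
    ∃ p : ℂ → E, (∀ z ∈ closedBall 0 1 ∩ N, HasDerivWithinAt v (p z) (closedBall 0 1) z) ∧
      ContDiffOn ℝ ∞ p (closedBall 0 1 ∩ N) ∧ DifferentiableOn ℂ p (ball 0 1 ∩ N) := by
  set D := closedBall (0 : ℂ) 1 ∩ N with hD
  have hsub : ball (0 : ℂ) 1 ∩ N ⊆ D := inter_subset_inter_left _ ball_subset_closedBall
  have hopen : IsOpen (ball (0 : ℂ) 1 ∩ N) := isOpen_ball.inter hN
  have huniq : UniqueDiffOn ℝ D := uniqueDiffOn_closedBall_inter hN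
  have hsmooth : ContDiffOn ℝ ∞ (fderivWithin ℝ v D) D := hv.fderivWithin huniq (by simp)
  have hinside {z : ℂ} (hz : z ∈ ball (0 : ℂ) 1 ∩ N) (η : ℂ) :
      fderivWithin ℝ v D z η = η • deriv v z := by
    have h1 := ((hd z hz).differentiableAt (hopen.mem_nhds hz)).hasDerivAt
    have h2 := h1.hasFDerivAt.restrictScalars ℝ
    rw [h2.hasFDerivWithinAt.fderivWithin (huniq z (hsub hz))]
    simp
  have hCR {z : ℂ} (hz : z ∈ D) (η : ℂ) :
      fderivWithin ℝ v D z η = η • fderivWithin ℝ v D z 1 := by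
    have hcl : z ∈ closure (ball (0 : ℂ) 1 ∩ N) := by
      have h1 : z ∈ closure (ball (0 : ℂ) 1) := by
        rw [closure_ball _ one_ne_zero]
        exact hz.1
      rw [inter_comm]
      exact hN.inter_closure ⟨hz.2, h1⟩
    have : (nhdsWithin z (ball (0 : ℂ) 1 ∩ N)).NeBot := mem_closure_iff_nhdsWithin_neBot.1 hcl
    -- The Cauchy–Riemann defect is continuous up to the boundary and vanishes on the interior,
    -- which is dense.
    have hc : ContinuousWithinAt (fun z => fderivWithin ℝ v D z η - η • fderivWithin ℝ v D z 1)
        (ball (0 : ℂ) 1 ∩ N) z := by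
      have hc0 := (hsmooth.continuousOn z hz).mono hsub
      exact (hc0.clm_apply continuousWithinAt_const).sub
        ((hc0.clm_apply continuousWithinAt_const).const_smul η)
    have hc' := hc.tendsto.congr' (f₂ := fun _ => (0 : E)) (by
      filter_upwards [self_mem_nhdsWithin] with w hw
      rw [hinside hw, hinside hw, one_smul, sub_self])
    exact sub_eq_zero.1 (tendsto_nhds_unique hc' tendsto_const_nhds)
  have hderiv {z : ℂ} (hz : z ∈ D) : HasDerivWithinAt v (fderivWithin ℝ v D z 1) D z := by
    refine HasFDerivWithinAt.of_restrictScalars ℝ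
      ((hv z hz).differentiableWithinAt (by simp)).hasFDerivWithinAt ?_
    ext1 η
    simp [hCR hz η]
  refine ⟨fun z => fderivWithin ℝ v D z 1, fun z hz => ?_, hsmooth.clm_apply contDiffOn_const, ?_⟩
  · exact (hasDerivWithinAt_inter (hN.mem_nhds hz.2)).1 (hderiv hz)
  · refine (hd.deriv hopen).congr fun z hz => ?_
    simp [hinside hz]

end Disc

/-! ### The energy density and the disc read in a chart -/

section Representation

variable {E : Type*} [NormedAddCommGroup E] [NormedSpace ℂ E]
variable {M : Type*} [TopologicalSpace M] [ChartedSpace E M] [IsManifold 𝓘(ℂ, E) ω M]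

/-- The squared length of `∂u/∂x` on the closed disc. -/
def discEnergy (g : RiemannMetric E M) (u : ℂ → M) (z : ℂ) : ℝ :=
  let X : TangentSpace 𝓘(ℝ, E) (u z) :=
    (mfderivWithin 𝓘(ℝ, ℂ) 𝓘(ℝ, E) u (closedBall 0 1) z : ℂ →L[ℝ] E) (1 : ℂ)
  g.inner (u z) X X

theorem discEnergy_nonneg (g : RiemannMetric E M) (u : ℂ → M) (z : ℂ) : 0 ≤ discEnergy g u z := by
  unfold discEnergy
  set X : TangentSpace 𝓘(ℝ, E) (u z) :=
    (mfderivWithin 𝓘(ℝ, ℂ) 𝓘(ℝ, E) u (closedBall 0 1) z : ℂ →L[ℝ] E) (1 : ℂ)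
  by_cases hX : X = 0
  · simp [hX]
  · exact (g.pos (u z) X hX).le

theorem discEnergy_eq_formInChart (g : RiemannMetric E M) {u : ℂ → M}
    {e : OpenPartialHomeomorph M E} (he : e ∈ atlas E M) {N : Set ℂ} (hN : IsOpen N)
    (hmaps : ∀ z ∈ closedBall 0 1 ∩ N, u z ∈ e.source) {z : ℂ} (hz : z ∈ closedBall 0 1 ∩ N)
    {w : E} (hw : HasDerivWithinAt (fun z => e (u z)) w (closedBall 0 1) z) :
    discEnergy g u z = formInChart g.inner e (e (u z)) w w := by
  have : IsManifold 𝓘(ℝ, E) 1 M := IsManifold.of_le (n := ω) (by simp)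
  have hw' := (hw.hasFDerivWithinAt.restrictScalars ℝ).hasMFDerivWithinAt
  have hsymm := (mdifferentiableAt_atlas_symm (I := 𝓘(ℝ, E)) he
    (e.map_source (hmaps z hz))).hasMFDerivAt
  have hcomp := hsymm.comp_hasMFDerivWithinAt z hw'
  have hEq : u =ᶠ[nhdsWithin z (closedBall 0 1)] e.symm ∘ fun z => e (u z) := by
    filter_upwards [self_mem_nhdsWithin, mem_nhdsWithin_of_mem_nhds (hN.mem_nhds hz.2)]
      with x hx hx'
    exact (e.left_inv (hmaps x ⟨hx, hx'⟩)).symm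
  have huniq : UniqueMDiffWithinAt 𝓘(ℝ, ℂ) (closedBall (0 : ℂ) 1) z := by
    have h := uniqueDiffOn_closedBall_inter isOpen_univ
    rw [inter_univ] at h
    exact (h z hz.1).uniqueMDiffWithinAt
  have hu := (hcomp.congr_of_eventuallyEq hEq (hEq.self_of_nhdsWithin hz.1)).mfderivWithin huniq
  have hX : (mfderivWithin 𝓘(ℝ, ℂ) 𝓘(ℝ, E) u (closedBall 0 1) z : ℂ →L[ℝ] E) (1 : ℂ)
      = (mfderiv 𝓘(ℝ, E) 𝓘(ℝ, E) e.symm (e (u z)) : E →L[ℝ] E) w :=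
    (DFunLike.congr_fun hu (1 : ℂ)).trans
      (congrArg (mfderiv 𝓘(ℝ, E) 𝓘(ℝ, E) e.symm (e (u z)) : E →L[ℝ] E) (one_smul ℂ w))
  have hg : (g.inner (u z) : E →L[ℝ] E →L[ℝ] ℝ) = g.inner (e.symm (e (u z))) := by
    rw [e.left_inv (hmaps z hz)]
  rw [formInChart_apply]
  exact congrArg₂ (fun (B : E →L[ℝ] E →L[ℝ] ℝ) (X : E) => B X X) hg hX

/-- A holomorphic disc read in a chart near a point of the closed disc, with its derivatives. -/
theorem IsHolomorphicDisc.exists_chart [CompleteSpace E] {u : ℂ → M} (hu : IsHolomorphicDisc E u)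
    {z₀ : ℂ} (hz₀ : z₀ ∈ closedBall (0 : ℂ) 1) :
    ∃ e ∈ atlas E M, ∃ N : Set ℂ, IsOpen N ∧ z₀ ∈ N ∧
      (∀ z ∈ closedBall 0 1 ∩ N, u z ∈ e.source) ∧ ∃ p q r : ℂ → E,
      ∀ z ∈ closedBall 0 1 ∩ N, HasDerivWithinAt (fun z => e (u z)) (p z) (closedBall 0 1) z ∧
        HasDerivWithinAt p (q z) (closedBall 0 1) z ∧
        HasDerivWithinAt q (r z) (closedBall 0 1) z := by
  have : IsManifold 𝓘(ℂ, E) 1 M := IsManifold.of_le (n := ω) (by simp)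
  set e := chartAt E (u z₀)
  have hea : e ∈ atlas E M := chart_mem_atlas E (u z₀)
  obtain ⟨N, hN, hNe⟩ := continuousOn_iff'.1 hu.smooth.continuousOn e.source e.open_source
  have hmaps : ∀ z ∈ closedBall 0 1 ∩ N, u z ∈ e.source := fun z hz =>
    (hNe.symm.subset ⟨hz.2, hz.1⟩).1
  have hz₀N : z₀ ∈ N := (hNe.subset ⟨mem_chart_source E (u z₀), hz₀⟩).1
  have hsm : ContDiffOn ℝ ∞ (fun z => e (u z)) (closedBall 0 1 ∩ N) := by
    have h1 : ContMDiffOn 𝓘(ℝ, E) 𝓘(ℝ, E) ω e e.source :=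
      contMDiffOn_of_mem_maximalAtlas (IsManifold.subset_maximalAtlas hea)
    exact ((h1.of_le (by simp)).comp (hu.smooth.mono inter_subset_left) hmaps).contDiffOn
  have hd : DifferentiableOn ℂ (fun z => e (u z)) (ball 0 1 ∩ N) := by
    have h1 : MDifferentiableOn 𝓘(ℂ, E) 𝓘(ℂ, E) e e.source := mdifferentiableOn_atlas hea
    exact (h1.comp (hu.holomorphic.mono inter_subset_left) fun z hz =>
      hmaps z ⟨ball_subset_closedBall hz.1, hz.2⟩).differentiableOn
  -- Three derivatives are needed: the energy involves v', and it is differentiated twice.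
  obtain ⟨p, hp, hpc, hpd⟩ := exists_hasDerivWithinAt_closedBall hN hsm hd
  obtain ⟨q, hq, hqc, hqd⟩ := exists_hasDerivWithinAt_closedBall hN hpc hpd
  obtain ⟨r, hr, -, -⟩ := exists_hasDerivWithinAt_closedBall hN hqc hqd
  exact ⟨e, hea, N, hN, hz₀N, hmaps, p, q, r, fun z hz => ⟨hp z hz, hq z hz, hr z hz⟩⟩

end Representation

/-! ### Maximum principle and conclusion -/

section Main

variable {E : Type*} [NormedAddCommGroup E] [NormedSpace ℂ E] [FiniteDimensional ℂ E]
variable {M : Type*} [TopologicalSpace M] [ChartedSpace E M] [IsManifold 𝓘(ℂ, E) ω M]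
variable {g : RiemannMetric E M} {u : ℂ → M}

theorem hasFDerivWithinAt_discEnergy (hg : IsKahler g) {e : OpenPartialHomeomorph M E}
    (he : e ∈ atlas E M) {N : Set ℂ} (hN : IsOpen N)
    (hmaps : ∀ z ∈ closedBall 0 1 ∩ N, u z ∈ e.source) {p q : ℂ → E}
    (hp : ∀ z ∈ closedBall 0 1 ∩ N, HasDerivWithinAt (fun z => e (u z)) (p z) (closedBall 0 1) z)
    {z : ℂ} (hz : z ∈ closedBall 0 1 ∩ N) (hq : HasDerivWithinAt p (q z) (closedBall 0 1) z) :
    HasFDerivWithinAt (discEnergy g u) ((2 : ℝ) • ((formInChart g.inner e (e (u z))).flip (p z) ∘L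
      (ContinuousLinearMap.toSpanSingleton ℂ (covAcceleration (formInChart g.inner e)
        (fun z => e (u z)) p q z)).restrictScalars ℝ)) (closedBall 0 1) z := by
  refine ((hg.isLocalKahler he).hasFDerivWithinAt_energy (v := fun z => e (u z))
    (e.map_source (hmaps z hz)) (hp z hz) hq).congr_of_eventuallyEq ?_
      (discEnergy_eq_formInChart g he hN hmaps hz (hp z hz))
  filter_upwards [self_mem_nhdsWithin, mem_nhdsWithin_of_mem_nhds (hN.mem_nhds hz.2)] with x hx hx'
  exact discEnergy_eq_formInChart g he hN hmaps ⟨hx, hx'⟩ (hp x ⟨hx, hx'⟩)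

theorem continuousOn_discEnergy (hg : IsKahler g) (hu : IsHolomorphicDisc E u) :
    ContinuousOn (discEnergy g u) (closedBall 0 1) := by
  have : CompleteSpace E := FiniteDimensional.complete ℂ E
  intro z hz
  obtain ⟨e, he, N, hN, hzN, hmaps, p, q, r, h⟩ := hu.exists_chart hz
  exact (hasFDerivWithinAt_discEnergy hg he hN hmaps (fun z hz => (h z hz).1) ⟨hz, hzN⟩
    (h z ⟨hz, hzN⟩).2.1).continuousWithinAt

/-- The energy plus a strictly subharmonic term has no interior maximum. -/
theorem not_isLocalMax_discEnergy (hg : IsKahler g) (hK : HasNonposSectionalCurvature g)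
    (hu : IsHolomorphicDisc E u) {ε : ℝ} (hε : 0 < ε) {z₀ : ℂ} (hz₀ : z₀ ∈ ball (0 : ℂ) 1) :
    ¬ IsLocalMax (fun z => discEnergy g u z + ε * ‖z‖ ^ 2) z₀ := by
  intro hmax
  have : CompleteSpace E := FiniteDimensional.complete ℂ E
  obtain ⟨e, he, N, hN, hzN, hmaps, p, q, r, h⟩ := hu.exists_chart (ball_subset_closedBall hz₀)
  have hopen : IsOpen (ball (0 : ℂ) 1 ∩ N) := isOpen_ball.inter hN
  have hsub {z : ℂ} (hz : z ∈ ball (0 : ℂ) 1 ∩ N) : z ∈ closedBall (0 : ℂ) 1 ∩ N :=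
    ⟨ball_subset_closedBall hz.1, hz.2⟩
  have hnhds {z : ℂ} (hz : z ∈ ball (0 : ℂ) 1 ∩ N) : closedBall (0 : ℂ) 1 ∈ nhds z :=
    Filter.mem_of_superset (isOpen_ball.mem_nhds hz.1) ball_subset_closedBall
  have hz₀' : z₀ ∈ ball (0 : ℂ) 1 ∩ N := ⟨hz₀, hzN⟩
  obtain ⟨h1, h2, h3⟩ := h z₀ (hsub hz₀')
  have htarget : e (u z₀) ∈ e.target := e.map_source (hmaps z₀ (hsub hz₀'))
  set G := formInChart g.inner e
  obtain ⟨L₁, L₂, hL₁, hL₂, hL⟩ := (hg.isLocalKahler he).laplacian_energy_nonneg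
    (v := fun z => e (u z)) htarget (fun a b => hK e he _ htarget a b)
    (h1.hasDerivAt (hnhds hz₀')) (h2.hasDerivAt (hnhds hz₀')) (h3.hasDerivAt (hnhds hz₀'))
  -- Second derivative test along the line z₀ + tη; the term ε‖z‖² contributes 2ε‖η‖². The sum over
  -- η = 1 and η = i contradicts subharmonicity.
  have key (η : ℂ) (L : ℂ →L[ℝ] ℝ) (hL : HasFDerivAt (fun z => 2 * G (e (u z))
      (η • covAcceleration G (fun z => e (u z)) p q z) (p z)) L z₀) :
      L η + 2 * ε * ‖η‖ ^ 2 ≤ 0 := by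
    have hline (t : ℝ) : HasDerivAt (fun t : ℝ => z₀ + (t : ℂ) * η) η t := by
      simpa using ((Complex.ofRealCLM.hasDerivAt (x := t)).mul_const η).const_add z₀
    have hline0 : z₀ + ((0 : ℝ) : ℂ) * η = z₀ := by simp
    have htend : Filter.Tendsto (fun t : ℝ => z₀ + (t : ℂ) * η) (nhds 0) (nhds z₀) := by
      simpa using (hline 0).continuousAt.tendsto
    refine second_deriv_nonpos_of_isLocalMax (a := 0)
      (φ := fun t : ℝ => discEnergy g u (z₀ + t * η) + ε * ‖z₀ + t * η‖ ^ 2)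
      (ψ := fun t : ℝ => 2 * G (e (u (z₀ + t * η)))
        (η • covAcceleration G (fun z => e (u z)) p q (z₀ + t * η)) (p (z₀ + t * η))
          + ε * (2 * inner ℝ (z₀ + t * η) η)) ?_ ?_ ?_
    · have := htend.eventually hmax
      simpa [IsLocalMax, IsMaxFilter] using this
    · filter_upwards [htend.eventually (hopen.mem_nhds hz₀')] with t ht
      have hd := (hasFDerivWithinAt_discEnergy hg he hN hmaps (fun z hz => (h z hz).1)
        (hsub ht) (h _ (hsub ht)).2.1).hasFDerivAt (hnhds ht)
      have hd1 := hd.comp_hasDerivAt t (hline t)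
      exact hd1.add ((hline t).norm_sq.const_mul ε)
    · have hL0 : HasFDerivAt (fun z => 2 * G (e (u z))
          (η • covAcceleration G (fun z => e (u z)) p q z) (p z)) L (z₀ + ((0 : ℝ) : ℂ) * η) := by
        rwa [hline0]
      have hd1 := hL0.comp_hasDerivAt 0 (hline 0)
      have hd2 := (((hline 0).inner ℝ (hasDerivAt_const (0 : ℝ) η)).const_mul 2).const_mul ε
      refine (hd1.add hd2).congr_deriv ?_
      simp
      ring
  have k1 := key 1 L₁ hL₁
  have k2 := key Complex.I L₂ hL₂
  simp at k1 k2
  linarith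

/-- On the boundary the geodesic equation fixes the radial derivative of the energy. -/
theorem discEnergy_le_of_isMaxOn_of_norm_eq_one (hg : IsKahler g) {γ : Circle → M}
    (hγ : IsClosedGeodesic g γ) (hu : IsHolomorphicDisc E u) (hbd : ∀ z : Circle, u z = γ z)
    {ε : ℝ} {ζ : ℂ} (hζ : ‖ζ‖ = 1)
    (hmax : IsMaxOn (fun z => discEnergy g u z + ε * ‖z‖ ^ 2) (closedBall 0 1) ζ) :
    discEnergy g u ζ ≤ ε := by
  have : CompleteSpace E := FiniteDimensional.complete ℂ E
  have hζs : ζ ∈ closedBall (0 : ℂ) 1 := by simp [hζ]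
  obtain ⟨e, he, N, hN, hzN, hmaps, p, q, r, h⟩ := hu.exists_chart hζs
  have hζN : ζ ∈ closedBall (0 : ℂ) 1 ∩ N := ⟨hζs, hzN⟩
  obtain ⟨h1, h2, -⟩ := h ζ hζN
  have htarget : e (u ζ) ∈ e.target := e.map_source (hmaps ζ hζN)
  have hloc := hg.isLocalKahler he
  obtain ⟨θ, hθ⟩ : ∃ θ : ℝ, (Circle.exp θ : ℂ) = ζ :=
    ⟨ζ.arg, by rw [Circle.coe_exp]; simpa [hζ] using Complex.norm_mul_exp_arg_mul_I ζ⟩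
  have hcircle (t : ℝ) : HasDerivAt (fun t : ℝ => (Circle.exp t : ℂ))
      (Complex.I * Circle.exp t) t := by
    simp only [Circle.coe_exp]
    have hd := ((Complex.ofRealCLM.hasDerivAt (x := t)).mul_const Complex.I).cexp
    refine hd.congr_deriv ?_
    simp [mul_comm]
  have hmem (t : ℝ) : (Circle.exp t : ℂ) ∈ closedBall (0 : ℂ) 1 := by simp
  have hev : ∀ᶠ t : ℝ in nhds θ, (Circle.exp t : ℂ) ∈ N :=
    (hcircle θ).continuousAt.eventually_mem (hN.mem_nhds (by rwa [hθ]))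
  have hc {t : ℝ} (ht : (Circle.exp t : ℂ) ∈ N) :
      HasDerivAt (fun t : ℝ => e (γ (Circle.exp t)))
        ((Complex.I * Circle.exp t : ℂ) • p (Circle.exp t)) t := by
    have hd := (h _ ⟨hmem t, ht⟩).1.scomp_hasDerivAt t (hcircle t) hmem
    simpa only [Function.comp_def, hbd] using hd
  have hcc : HasDerivAt (deriv fun t : ℝ => e (γ (Circle.exp t)))
      ((Complex.I * ζ) • (Complex.I * ζ) • q ζ + (Complex.I * (Complex.I * ζ)) • p ζ) θ := by
    have hpd := h2
    rw [← hθ] at hpd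
    have hd := ((hcircle θ).const_mul Complex.I).smul (hpd.scomp_hasDerivAt θ (hcircle θ) hmem)
    rw [← hθ]
    refine hd.congr_of_eventuallyEq ?_
    filter_upwards [hev] with t ht using (hc ht).deriv
  have hgeo := hγ.geodesic e he θ (by rw [← hbd, hθ]; exact hmaps ζ hζN)
  rw [hcc.deriv, (hc (by rwa [hθ])).deriv, ← hbd, hθ, ← christoffelOp_apply,
    hloc.christoffelOp_smul_left htarget, hloc.christoffelOp_smul_right htarget] at hgeo
  set A := covAcceleration (formInChart g.inner e) (fun z => e (u z)) p q ζ with hA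
  have hζA : ζ • A = - p ζ := by
    have hne : ζ ≠ 0 := by
      rintro rfl
      simp at hζ
    -- Since (iζ)² = -ζ² and i(iζ) = -ζ, the left side of the geodesic equation is -ζ(p + ζA).
    have hz : ζ • (p ζ + ζ • A) = 0 := by
      rw [← neg_eq_zero, ← hgeo, hA, covAcceleration]
      have hI : Complex.I * ζ * (Complex.I * ζ) = - (ζ * ζ) := by
        linear_combination ζ * ζ * Complex.I_mul_I
      have hI' : Complex.I * (Complex.I * ζ) = - ζ := by
        linear_combination ζ * Complex.I_mul_I
      simp only [smul_add, smul_smul, hI, hI', neg_smul, neg_add]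
      abel
    exact eq_neg_of_add_eq_zero_right ((smul_eq_zero.1 hz).resolve_left hne)
  have hd := hasFDerivWithinAt_discEnergy hg he hN hmaps (fun z hz => (h z hz).1) hζN h2
  have hd2 := hd.add (((hasStrictFDerivAt_norm_sq ζ).hasFDerivAt.hasFDerivWithinAt
    (s := closedBall 0 1)).const_mul ε)
  -- Only the inward radial direction is tested: the segment from ζ to ζ + (-ζ) = 0 stays in the
  -- disc. The derivative there is 2 G(p, p) - 2ε, by ζA = -p.
  have hcone : -ζ ∈ posTangentConeAt (closedBall (0 : ℂ) 1) ζ := by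
    refine mem_posTangentConeAt_of_segment_subset ?_
    refine (convex_closedBall (0 : ℂ) 1).segment_subset hζs ?_
    simp
  have hle := hmax.localize.hasFDerivWithinAt_nonpos hd2 hcone
  have hE := discEnergy_eq_formInChart g he hN hmaps hζN h1
  simp [← hA, hζA, hζ] at hle
  rw [hE]
  linarith

theorem discEnergy_eq_zero (hg : IsKahler g) (hK : HasNonposSectionalCurvature g)
    {γ : Circle → M} (hγ : IsClosedGeodesic g γ) (hu : IsHolomorphicDisc E u)
    (hbd : ∀ z : Circle, u z = γ z) {z : ℂ} (hz : z ∈ closedBall (0 : ℂ) 1) :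
    discEnergy g u z = 0 := by
  refine le_antisymm (le_of_forall_pos_le_add fun δ hδ => ?_) (discEnergy_nonneg g u z)
  -- With ε = δ/2, the two bounds f(z) ≤ f(ζ) + ε and f(ζ) ≤ ε add up to δ.
  have hε : 0 < δ / 2 := half_pos hδ
  have hcont : ContinuousOn (fun z => discEnergy g u z + δ / 2 * ‖z‖ ^ 2) (closedBall 0 1) :=
    (continuousOn_discEnergy hg hu).add (by fun_prop)
  obtain ⟨ζ, hζ, hmax⟩ := (isCompact_closedBall (0 : ℂ) 1).exists_isMaxOn ⟨0, by simp⟩ hcont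
  have hnorm : ‖ζ‖ = 1 := by
    by_contra hne
    have hball : ζ ∈ ball (0 : ℂ) 1 :=
      mem_ball_zero_iff.2 (lt_of_le_of_ne (mem_closedBall_zero_iff.1 hζ) hne)
    exact not_isLocalMax_discEnergy hg hK hu hε hball (hmax.isLocalMax
      (Filter.mem_of_superset (isOpen_ball.mem_nhds hball) ball_subset_closedBall))
  have h1 := discEnergy_le_of_isMaxOn_of_norm_eq_one hg hγ hu hbd hnorm hmax
  have h2 : discEnergy g u z + δ / 2 * ‖z‖ ^ 2 ≤ discEnergy g u ζ + δ / 2 * ‖ζ‖ ^ 2 := hmax hz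
  rw [hnorm] at h2
  nlinarith [sq_nonneg ‖z‖]

/-- A holomorphic disc without energy is constant. -/
theorem eq_of_discEnergy_eq_zero (hg : IsKahler g) (hu : IsHolomorphicDisc E u)
    (h0 : ∀ z ∈ closedBall (0 : ℂ) 1, discEnergy g u z = 0) {z w : ℂ}
    (hz : z ∈ closedBall (0 : ℂ) 1) (hw : w ∈ closedBall (0 : ℂ) 1) : u z = u w := by
  have : CompleteSpace E := FiniteDimensional.complete ℂ E
  -- Connectedness reduces the claim to local constancy: zero energy forces p = 0, and the mean
  -- value inequality applies on a convex piece of the disc.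
  refine (convex_closedBall (0 : ℂ) 1).isPreconnected.induction₂ (fun z w => u z = u w)
    (fun z hz => ?_) (fun _ _ _ _ _ _ => Eq.trans) (fun _ _ _ _ => Eq.symm) hz hw
  obtain ⟨e, he, N, hN, hzN, hmaps, p, q, r, h⟩ := hu.exists_chart hz
  obtain ⟨ρ, hρ, hρN⟩ := Metric.isOpen_iff.1 hN z hzN
  filter_upwards [self_mem_nhdsWithin, mem_nhdsWithin_of_mem_nhds (ball_mem_nhds z hρ)] with w hw hwρ
  have hsub : closedBall (0 : ℂ) 1 ∩ ball z ρ ⊆ closedBall 0 1 ∩ N :=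
    inter_subset_inter_right _ hρN
  have hp {x : ℂ} (hx : x ∈ closedBall (0 : ℂ) 1 ∩ N) : p x = 0 := by
    by_contra hne
    have := (hg.isLocalKahler he).pos _ (e.map_source (hmaps x hx)) _ hne
    rw [← discEnergy_eq_formInChart g he hN hmaps hx (h x hx).1, h0 x hx.1] at this
    exact this.false
  have hconst := ((convex_closedBall (0 : ℂ) 1).inter
    (convex_ball z ρ)).norm_image_sub_le_of_norm_hasDerivWithin_le
      (f := fun z => e (u z)) (C := 0)
      (fun x hx => (h x (hsub hx)).1.mono inter_subset_left)
    (fun x hx => by rw [hp (hsub hx), norm_zero]) ⟨hz, mem_ball_self hρ⟩ ⟨hw, hwρ⟩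
  have heq : e (u w) = e (u z) := by
    rw [zero_mul] at hconst
    exact sub_eq_zero.1 (norm_le_zero_iff.1 hconst)
  exact e.injOn (hmaps z ⟨hz, hzN⟩) (hmaps w (hsub ⟨hw, hwρ⟩)) heq.symm

end Main

end KahlerGeom

end

theorem mainTheorem6
    {E : Type*} [NormedAddCommGroup E] [NormedSpace ℂ E] [FiniteDimensional ℂ E]
    {M : Type*} [TopologicalSpace M] [T2Space M] [SecondCountableTopology M]
    [ChartedSpace E M] [IsManifold 𝓘(ℂ, E) ω M]
    (g : KahlerGeom.RiemannMetric E M) (hg : KahlerGeom.IsKahler g)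
    (hK : KahlerGeom.HasNonposSectionalCurvature g)
    (γ : Circle → M) (hγ : KahlerGeom.IsClosedGeodesic g γ) :
    ¬ ∃ u : ℂ → M, KahlerGeom.IsHolomorphicDisc E u ∧
        (∀ z : Circle, u (z : ℂ) = γ z) ∧
        ¬ ∃ p : M, ∀ z ∈ closedBall (0 : ℂ) 1, u z = p := by
  rintro ⟨u, hu, hbd, hne⟩
  refine hne ⟨u 0, fun z hz => ?_⟩
  exact KahlerGeom.eq_of_discEnergy_eq_zero hg hu
    (fun w hw => KahlerGeom.discEnergy_eq_zero hg hK hγ hu hbd hw) hz (by simp)
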